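/- For a rational number $a$ and an integer $n\ge 0$ let $(a)_n=a(a+1)\cdots(a+n-1)$ denote the rising factorial, with $(a)_0=1$. For rational numbers $x,y$ and a positive integer $m$, write $x\equiv y\pmod m$ if $m$ divides the numerator of $x-y$ written in lowest terms. Let $p$ be a prime with $p\equiv 3\pmod 4$ and let $r\ge 1$ be an integer. Then $$\sum_{k=0}^{(p^{2r}-1)/2}\frac{(\frac12)_k^3}{k!^3}\equiv p^{2r}\,\frac{(\frac34)_{(p^{2r}-1)/2}}{(\frac54)_{(p^{2r}-1)/2}}\pmod{p^{2r+2}}$$ and $$\sum_{k=0}^{p^{2r}-1}\frac{(\frac12)_k^3}{k!^3}\equiv p^{2r}\,\frac{(\frac34)_{(p^{2r}-1)/2}}{(\frac54)_{(p^{2r}-1)/2}}\pmod{p^{2r+2}}.$$ -/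

import Mathlib

/-- Congruence of rational numbers modulo `m`: the integer `m` divides the numerator of `x - y` in
lowest terms. (The denominator of `x - y` is then coprime to `m`. For a prime power `m = p ^ e`
with `e ≥ 1` this says that `x - y` lies in `p ^ e ℤ_(p)`.) -/
def RatModEq (m : ℕ) (x y : ℚ) : Prop :=
  (m : ℤ) ∣ (x - y).num

/-- The rising factorial `(a)_n = a (a + 1) ⋯ (a + n - 1)` of a rational number. -/
def risingFactorial (a : ℚ) (n : ℕ) : ℚ :=
  ∏ i ∈ Finset.range n, (a + (i : ℚ))

/-! Write n = p ^ (2r). In the truncated series, replace two of the three equal numerator parameters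
so that each term becomes a polynomial in y, and recover y = 0 by Lagrange interpolation at odd
squares. At each node the series is a terminating Watson sum: zero at odd index, and a square at
index 2M, equal to `halfRatio M ^ 2` for offset 0 (`sum_cube_eq_interpolate`,
`sum_watsonTerm_even`).

For the first half, the top node is n². Its Lagrange coefficient is 1 modulo p², and
`mul_risingFactorial_div_eq` gives the target as the same square times another factor that is 1
modulo p²; the square itself supplies p ^ (2r). Every other coefficient has n² in its numerator. Its
small denominators are offset by carries: since p ≡ 3 mod 4, each odd power of p dividing 4M + 1
forces a carry in M + M, hence by Kummer a factor p of the central binomial coefficient.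

The remaining terms, with k > (n - 1) / 2, contribute 0. A second interpolation, at the nodes l²,
deforms the denominators so that the series starts at l; the Watson expansion then applies with
offset l. Each resulting term again carries n², now with two central binomial coefficients, one
having an additional carry at the leading digit. -/

/-! ### Terminating Watson sums -/

/-- The terms of the terminating hypergeometric series
`₃F₂(l + 1/2, -j, 2l + 1 + j; l + 1, 2l + 1; 1)`. -/
def watsonTerm (l j t : ℕ) : ℚ :=
  ∏ i ∈ Finset.range t, (((l : ℚ) + 1 / 2 + i) * ((i : ℚ) - j) * (2 * l + 1 + i + j) /
    ((l + 1 + i) * (i + 1) * (2 * l + 1 + i)))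

lemma watsonTerm_succ (l j t : ℕ) : watsonTerm l j (t + 1) =
    watsonTerm l j t * (((l : ℚ) + 1 / 2 + t) * ((t : ℚ) - j) * (2 * l + 1 + t + j) /
    ((l + 1 + t) * (t + 1) * (2 * l + 1 + t))) := by
  rw [watsonTerm, Finset.prod_range_succ, ← watsonTerm]

lemma watsonTerm_eq_zero {l j t : ℕ} (h : j < t) : watsonTerm l j t = 0 := by
  refine Finset.prod_eq_zero (Finset.mem_range.2 h) ?_
  simp

/-- The ratio is taken in this direction because its inverse would divide by zero at t = j + 1 and t
= j + 2. -/
lemma watsonTerm_add_two (l j t : ℕ) : watsonTerm l j t = watsonTerm l (j + 2) t *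
    (((t : ℚ) - j - 2) * (t - j - 1) * (2 * l + j + 1) * (2 * l + j + 2) /
      ((j + 1) * (j + 2) * (2 * l + j + t + 1) * (2 * l + j + t + 2))) := by
  induction t with
  | zero =>
    simp only [watsonTerm, Finset.range_zero, Finset.prod_empty, Nat.cast_zero]
    field_simp
    ring
  | succ t ih =>
    rw [watsonTerm_succ, watsonTerm_succ, ih]
    push_cast
    field_simp
    ring

/-- A creative telescoping certificate: the right side vanishes once T > j + 2, which leaves a
two-step recurrence in j for the full sums. -/
lemma watsonTerm_telescope (l j T : ℕ) :
    ∑ t ∈ Finset.range T, ((2 * (l : ℚ) + 2 + j) ^ 2 * watsonTerm l (j + 2) t -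
      ((j : ℚ) + 1) ^ 2 * watsonTerm l j t) =
    -(2 * (2 * j + 2 * l + 3) * (j + 2 * l + 2) * T * (T + l) * (T + 2 * l) /
      ((j + 2) * (2 * l + j + T + 1) * (2 * l + j + T + 2))) * watsonTerm l (j + 2) T := by
  induction T with
  | zero => simp
  | succ T ih =>
    rw [Finset.sum_range_succ, ih, watsonTerm_succ, watsonTerm_add_two l j T]
    push_cast
    field_simp
    ring

/-- Terminating sums of the series do not depend on the truncation. -/
lemma sum_watsonTerm_of_lt {l j D : ℕ} (h : j < D) :
    ∑ t ∈ Finset.range D, watsonTerm l j t = ∑ t ∈ Finset.range (j + 1), watsonTerm l j t := by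
  refine (Finset.sum_subset (Finset.range_subset_range.2 h) fun t _ ht => ?_).symm
  exact watsonTerm_eq_zero (by simpa using ht)

lemma sum_watsonTerm_add_two (l j : ℕ) :
    (2 * (l : ℚ) + 2 + j) ^ 2 * ∑ t ∈ Finset.range (j + 3), watsonTerm l (j + 2) t =
      ((j : ℚ) + 1) ^ 2 * ∑ t ∈ Finset.range (j + 1), watsonTerm l j t := by
  have h := watsonTerm_telescope l j (j + 3)
  rw [watsonTerm_eq_zero (show j + 2 < j + 3 by omega), mul_zero, Finset.sum_sub_distrib,
    ← Finset.mul_sum, ← Finset.mul_sum, sum_watsonTerm_of_lt (show j < j + 3 by omega)] at h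
  linarith

lemma sum_watsonTerm_odd (l M : ℕ) :
    ∑ t ∈ Finset.range (2 * M + 1 + 1), watsonTerm l (2 * M + 1) t = 0 := by
  induction M with
  | zero =>
    simp only [watsonTerm, Finset.sum_range_succ, Finset.prod_range_succ, Finset.range_zero]
    norm_num
    field_simp
    ring
  | succ M ih =>
    have h := sum_watsonTerm_add_two l (2 * M + 1)
    rw [ih, mul_zero] at h
    rcases mul_eq_zero.1 h with h | h
    · have : (0 : ℚ) < 2 * (l : ℚ) + 2 + (2 * M + 1 : ℕ) := by positivity
      exact absurd h (by positivity)
    · exact h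

/-- The terminating case of Watson's summation formula. -/
lemma sum_watsonTerm_even (l M : ℕ) :
    ∑ t ∈ Finset.range (2 * M + 1), watsonTerm l (2 * M) t =
      (∏ i ∈ Finset.range M, ((2 * i + 1 : ℚ) / (2 * l + 2 + 2 * i))) ^ 2 := by
  induction M with
  | zero => simp [watsonTerm]
  | succ M ih =>
    have h := sum_watsonTerm_add_two l (2 * M)
    rw [ih] at h
    have h0 : (2 * (l : ℚ) + 2 + (2 * M : ℕ)) ^ 2 ≠ 0 := by positivity
    refine mul_left_cancel₀ h0 (h.trans ?_)
    rw [Finset.prod_range_succ]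
    push_cast
    field_simp

/-! ### Lagrange interpolation at zero -/

open Polynomial in
/-- Lagrange interpolation evaluated at `0`. -/
lemma eval_zero_eq_sum_interpolate {ι : Type*} [DecidableEq ι] (s : Finset ι) (v : ι → ℚ)
    (hv : Set.InjOn v s) (P : ℚ[X]) (hP : P.degree < s.card) :
    P.eval 0 = ∑ i ∈ s, P.eval (v i) * ∏ j ∈ s.erase i, v j / (v j - v i) := by
  have h := Lagrange.eq_interpolate hv hP
  conv_lhs => rw [h]
  rw [Lagrange.interpolate_apply, eval_finsetSum]
  refine Finset.sum_congr rfl fun i hi => ?_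
  rw [eval_mul, eval_C, Lagrange.basis, eval_prod]
  congr 1
  refine Finset.prod_congr rfl fun j hj => ?_
  have hne : v i - v j ≠ 0 := sub_ne_zero.2 fun e =>
    (Finset.ne_of_mem_erase hj) (hv (Finset.mem_of_mem_erase hj) hi e.symm)
  have hne' : v j - v i ≠ 0 := by rwa [← neg_ne_zero, neg_sub]
  simp only [Lagrange.basisDivisor, eval_mul, eval_C, eval_sub, eval_X]
  field_simp
  ring

open Polynomial in
lemma degree_sum_prod_linear_lt (D : ℕ) (c : ℕ → ℚ) (S : ℕ → Finset ℕ) (f g : ℕ → ℚ)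
    (T : Finset ℕ) (hS : ∀ t ∈ T, (S t).card < D) :
    (∑ t ∈ T, C (c t) * ∏ i ∈ S t, (C (f i) + C (g i) * X)).degree < D := by
  rw [← mem_degreeLT]
  refine Submodule.sum_mem _ fun t ht => ?_
  rw [← smul_eq_C_mul]
  refine Submodule.smul_mem _ _ (mem_degreeLT.2 ?_)
  refine lt_of_le_of_lt (degree_prod_le _ _) ?_
  calc ∑ i ∈ S t, (C (f i) + C (g i) * X).degree ≤ ∑ i ∈ S t, (1 : WithBot ℕ) := by
        refine Finset.sum_le_sum fun i _ => ?_
        rw [add_comm]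
        exact degree_linear_le
    _ = ((S t).card : WithBot ℕ) := by simp
    _ < D := by exact_mod_cast hS t ht

open Polynomial in
/-- The truncated series with three equal numerator parameters, expanded in terminating ones. -/
lemma sum_cube_eq_interpolate (l D : ℕ) :
    ∑ t ∈ Finset.range D, ∏ i ∈ Finset.range t,
      (((l : ℚ) + 1 / 2 + i) ^ 3 / ((l + 1 + i) * (i + 1) * (2 * l + 1 + i))) =
    ∑ j ∈ Finset.range D, (∑ t ∈ Finset.range (j + 1), watsonTerm l j t) *
      ∏ b ∈ (Finset.range D).erase j, ((2 * l + 2 * b + 1 : ℚ) ^ 2 /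
        ((2 * l + 2 * b + 1) ^ 2 - (2 * l + 2 * j + 1) ^ 2)) := by
  set c : ℕ → ℚ := fun t => ∏ i ∈ Finset.range t,
    (((l : ℚ) + 1 / 2 + i) / (4 * ((l + 1 + i) * (i + 1) * (2 * l + 1 + i)))) with hc
  -- Two numerator factors are deformed to (2l+2i+1)² - y. At y = (2l+2j+1)² this is
  -- 4(i-j)(2l+1+i+j), which gives the Watson term; the 4 is absorbed in `c`.
  set P : ℚ[X] := ∑ t ∈ Finset.range D, C (c t) * ∏ i ∈ Finset.range t,
    (C ((2 * l + 2 * i + 1 : ℚ) ^ 2) + C (-1) * X) with hP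
  have hev : ∀ y, P.eval y = ∑ t ∈ Finset.range D, ∏ i ∈ Finset.range t,
      (((l : ℚ) + 1 / 2 + i) / (4 * ((l + 1 + i) * (i + 1) * (2 * l + 1 + i))) *
        ((2 * l + 2 * i + 1 : ℚ) ^ 2 - y)) := by
    intro y
    simp [hP, hc, eval_finsetSum, eval_prod, Finset.prod_mul_distrib, sub_eq_add_neg]
  have hinj : Set.InjOn (fun b : ℕ => (2 * l + 2 * b + 1 : ℚ) ^ 2) (Finset.range D) := by
    intro a _ b _ hab
    have := (pow_left_inj₀ (show (0 : ℚ) ≤ 2 * l + 2 * a + 1 by positivity)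
      (show (0 : ℚ) ≤ 2 * l + 2 * b + 1 by positivity) two_ne_zero).1 hab
    have h2 : (a : ℚ) = b := by linarith
    exact_mod_cast h2
  have h := eval_zero_eq_sum_interpolate (Finset.range D) _ hinj P (by
    rw [hP, Finset.card_range]
    refine degree_sum_prod_linear_lt D c _ (fun i : ℕ => (2 * l + 2 * i + 1 : ℚ) ^ 2)
      (fun _ => -1) _ fun t ht => ?_
    simpa using ht)
  rw [hev] at h
  convert h using 1
  · refine Finset.sum_congr rfl fun t _ => Finset.prod_congr rfl fun i _ => ?_
    field_simp
    ring
  · refine Finset.sum_congr rfl fun j hj => ?_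
    congr 1
    rw [hev, ← sum_watsonTerm_of_lt (Finset.mem_range.1 hj)]
    refine Finset.sum_congr rfl fun t _ => Finset.prod_congr rfl fun i _ => ?_
    field_simp
    ring

/-! ### Central binomial ratios and the deformed tail -/

/-- The central binomial coefficient over the power of four, `(1/2)_k / k!`. -/
def halfRatio (k : ℕ) : ℚ := (k.centralBinom : ℚ) / 4 ^ k

lemma halfRatio_succ (k : ℕ) :
    halfRatio (k + 1) = halfRatio k * (((k : ℚ) + 1 / 2) / (k + 1)) := by
  have h : ((k : ℚ) + 1) * ((k + 1).centralBinom : ℚ) = 2 * (2 * k + 1) * k.centralBinom := by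
    exact_mod_cast Nat.succ_mul_centralBinom_succ k
  rw [halfRatio, halfRatio, pow_succ]
  field_simp
  linarith

lemma halfRatio_eq_prod (k : ℕ) :
    halfRatio k = ∏ i ∈ Finset.range k, ((2 * i + 1 : ℚ) / (2 + 2 * i)) := by
  induction k with
  | zero => simp [halfRatio]
  | succ k ih =>
    rw [halfRatio_succ, Finset.prod_range_succ, ih]
    congr 1
    field_simp
    ring

lemma risingFactorial_half_div_factorial (k : ℕ) :
    risingFactorial (1 / 2) k / (k.factorial : ℚ) = halfRatio k := by
  induction k with
  | zero => simp [risingFactorial, halfRatio]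
  | succ k ih =>
    rw [halfRatio_succ, ← ih, Nat.factorial_succ]
    simp only [risingFactorial, Finset.prod_range_succ]
    push_cast
    field_simp
    ring

lemma halfRatio_eq_factorial (k : ℕ) :
    halfRatio k = ((2 * k).factorial : ℚ) / ((k.factorial : ℚ) ^ 2 * 4 ^ k) := by
  rw [halfRatio, Nat.centralBinom, Nat.cast_choose ℚ (by omega : k ≤ 2 * k),
    show 2 * k - k = k by omega]
  field_simp

/-- The terms of the truncated series started at an offset `l`, with denominators deformed. -/
def shiftedTerm (l t : ℕ) : ℚ :=
  ∏ i ∈ Finset.range t, (((l : ℚ) + 1 / 2 + i) ^ 3 / ((l + 1 + i) * (i + 1) * (2 * l + 1 + i)))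

lemma shiftedTerm_succ (l t : ℕ) : shiftedTerm l (t + 1) = shiftedTerm l t *
    (((l : ℚ) + 1 / 2 + t) ^ 3 / ((l + 1 + t) * (t + 1) * (2 * l + 1 + t))) := by
  rw [shiftedTerm, Finset.prod_range_succ, ← shiftedTerm]

lemma shiftedTerm_zero_left (t : ℕ) : shiftedTerm 0 t = halfRatio t ^ 3 := by
  induction t with
  | zero => simp [shiftedTerm, halfRatio]
  | succ t ih =>
    rw [shiftedTerm_succ, ih, halfRatio_succ]
    push_cast
    field_simp
    ring

-- The k-th term is multiplied by ∏ (1 - y / i²) over k < i < n, of degree below n - A in y. At y =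
-- l² the terms with k < l vanish, so the series effectively starts at l.
open Polynomial in
lemma sum_Ico_eq_interpolate (c : ℕ → ℚ) (A n : ℕ) :
    ∑ k ∈ Finset.Ico A n, c k = ∑ l ∈ Finset.Ico A n,
      (∑ k ∈ Finset.Ico A n, c k * ∏ i ∈ Finset.Ico (k + 1) n, (1 - (l : ℚ) ^ 2 / i ^ 2)) *
      ∏ i ∈ (Finset.Ico A n).erase l, ((i : ℚ) ^ 2 / (i ^ 2 - l ^ 2)) := by
  set P : ℚ[X] := ∑ k ∈ Finset.Ico A n, C (c k) * ∏ i ∈ Finset.Ico (k + 1) n,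
    (C 1 + C (-1 / (i : ℚ) ^ 2) * X) with hP
  have hev : ∀ y, P.eval y = ∑ k ∈ Finset.Ico A n,
      c k * ∏ i ∈ Finset.Ico (k + 1) n, (1 + -1 / (i : ℚ) ^ 2 * y) := by
    intro y
    simp [hP, eval_finsetSum, eval_prod]
  have hinj : Set.InjOn (fun b : ℕ => (b : ℚ) ^ 2) (Finset.Ico A n) := by
    intro a _ b _ hab
    exact_mod_cast (pow_left_inj₀ (Nat.cast_nonneg (α := ℚ) a)
      (Nat.cast_nonneg b) two_ne_zero).1 hab
  have h := eval_zero_eq_sum_interpolate (Finset.Ico A n) _ hinj P (by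
    rw [hP, Nat.card_Ico]
    refine degree_sum_prod_linear_lt (n - A) c _ (fun _ => 1)
      (fun i : ℕ => -1 / (i : ℚ) ^ 2) _ fun k hk => ?_
    rw [Finset.mem_Ico] at hk
    rw [Nat.card_Ico]
    omega)
  rw [hev] at h
  convert h using 1
  · simp
  · refine Finset.sum_congr rfl fun l _ => ?_
    congr 1
    rw [hev]
    refine Finset.sum_congr rfl fun k _ => ?_
    congr 1
    refine Finset.prod_congr rfl fun i _ => ?_
    ring

/-- Raising t by one removes the factor 1 - l²/(l+t+1)² = (t+1)(2l+1+t)/(l+1+t)². Dividing by it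
turns two of the three denominators l+1+t into t+1 and 2l+1+t. -/
lemma halfRatio_cube_mul_prod_Ico (l n : ℕ) {t : ℕ} (ht : l + t < n) :
    halfRatio (l + t) ^ 3 * ∏ i ∈ Finset.Ico (l + t + 1) n, (1 - (l : ℚ) ^ 2 / i ^ 2) =
      halfRatio l ^ 3 * (∏ i ∈ Finset.Ico (l + 1) n, (1 - (l : ℚ) ^ 2 / i ^ 2)) *
        shiftedTerm l t := by
  induction t with
  | zero => simp [shiftedTerm]
  | succ t ih =>
    rw [shiftedTerm_succ, ← mul_assoc, ← ih (by omega), ← add_assoc, halfRatio_succ,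
      Finset.prod_eq_prod_Ico_succ_bot (show l + t + 1 < n by omega)]
    push_cast
    have h : (1 - (l : ℚ) ^ 2 / (l + t + 1) ^ 2) =
        (t + 1) * (2 * l + 1 + t) / (l + 1 + t) ^ 2 := by
      field_simp
      ring
    rw [h]
    field_simp
    ring

lemma sum_Ico_halfRatio_cube (A n : ℕ) :
    ∑ k ∈ Finset.Ico A n, halfRatio k ^ 3 = ∑ l ∈ Finset.Ico A n,
      halfRatio l ^ 3 * (∏ i ∈ Finset.Ico A l, ((i : ℚ) ^ 2 / (i ^ 2 - l ^ 2))) *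
        ∑ t ∈ Finset.range (n - l), shiftedTerm l t := by
  rw [sum_Ico_eq_interpolate]
  refine Finset.sum_congr rfl fun l hl => ?_
  rw [Finset.mem_Ico] at hl
  have h1 : ∑ k ∈ Finset.Ico A n, halfRatio k ^ 3 *
      ∏ i ∈ Finset.Ico (k + 1) n, (1 - (l : ℚ) ^ 2 / i ^ 2) =
      halfRatio l ^ 3 * (∏ i ∈ Finset.Ico (l + 1) n, (1 - (l : ℚ) ^ 2 / i ^ 2)) *
        ∑ t ∈ Finset.range (n - l), shiftedTerm l t := by
    rw [← Finset.sum_Ico_consecutive _ hl.1 hl.2.le, Finset.sum_eq_zero, zero_add,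
      Finset.sum_Ico_eq_sum_range, Finset.mul_sum]
    · refine Finset.sum_congr rfl fun t ht => ?_
      rw [Finset.mem_range] at ht
      exact halfRatio_cube_mul_prod_Ico l n (by omega)
    · intro k hk
      rw [Finset.mem_Ico] at hk
      have hl0 : (l : ℚ) ≠ 0 := Nat.cast_ne_zero.2 (by omega)
      rw [Finset.prod_eq_zero (i := l) (Finset.mem_Ico.2 (by omega)), mul_zero]
      field_simp
      ring
  -- The nodes above l cancel against the deformation product, so only the nodes below l survive.
  have h2 : (∏ i ∈ Finset.Ico (l + 1) n, (1 - (l : ℚ) ^ 2 / i ^ 2)) *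
      ∏ i ∈ (Finset.Ico A n).erase l, ((i : ℚ) ^ 2 / (i ^ 2 - l ^ 2)) =
      ∏ i ∈ Finset.Ico A l, ((i : ℚ) ^ 2 / (i ^ 2 - l ^ 2)) := by
    have he : (Finset.Ico A n).erase l = Finset.Ico A l ∪ Finset.Ico (l + 1) n := by
      ext i
      simp only [Finset.mem_erase, Finset.mem_Ico, Finset.mem_union]
      omega
    rw [he, Finset.prod_union, mul_left_comm, ← Finset.prod_mul_distrib]
    · refine (congrArg _ (Finset.prod_eq_one fun i hi => ?_)).trans (mul_one _)
      rw [Finset.mem_Ico] at hi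
      have hi0 : (i : ℚ) ≠ 0 := Nat.cast_ne_zero.2 (by omega)
      have hlt : (l : ℚ) < i := by exact_mod_cast hi.1
      have : (i : ℚ) ^ 2 - l ^ 2 ≠ 0 := by
        have : (l : ℚ) ^ 2 < i ^ 2 := by gcongr
        linarith
      field_simp
    · rw [Finset.disjoint_left]
      intro i hi hi'
      rw [Finset.mem_Ico] at hi hi'
      omega
  rw [h1, ← h2]
  ring

/-! ### Lagrange coefficients in factorials -/

lemma prod_range_add_one_add (m k : ℕ) :
    ∏ i ∈ Finset.range k, ((m : ℚ) + 1 + i) = ((m + k).factorial : ℚ) / m.factorial := by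
  induction k with
  | zero => simp [Nat.factorial_ne_zero]
  | succ k ih =>
    rw [Finset.prod_range_succ, ih, ← add_assoc, Nat.factorial_succ]
    push_cast
    ring

lemma prod_range_sub_self (x : ℕ) :
    ∏ i ∈ Finset.range x, ((i : ℚ) - x) = (-1) ^ x * x.factorial := by
  induction x with
  | zero => simp
  | succ x ih =>
    rw [Finset.prod_range_succ', Nat.factorial_succ, pow_succ]
    simp only [Nat.cast_add, Nat.cast_one, add_sub_add_right_eq_sub, ih]
    push_cast
    ring

lemma prod_range_odd (m k : ℕ) :
    ∏ i ∈ Finset.range k, (2 * (m : ℚ) + 2 * i + 1) =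
      ((2 * m + 2 * k).factorial * m.factorial : ℚ) /
        ((2 * m).factorial * (m + k).factorial * 2 ^ k) := by
  induction k with
  | zero =>
    have := Nat.factorial_ne_zero m
    have := Nat.factorial_ne_zero (2 * m)
    simp
    field_simp
  | succ k ih =>
    rw [Finset.prod_range_succ, ih, ← add_assoc, mul_add 2 k 1, mul_one, ← add_assoc,
      Nat.factorial_succ, Nat.factorial_succ, Nat.factorial_succ, pow_succ]
    push_cast
    field_simp
    ring

lemma prod_range_erase (f : ℕ → ℚ) (x d : ℕ) :
    ∏ b ∈ (Finset.range (x + 1 + d)).erase x, f b =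
      (∏ i ∈ Finset.range x, f i) * ∏ i ∈ Finset.range d, f (x + 1 + i) := by
  have he : (Finset.range (x + 1 + d)).erase x =
      Finset.range x ∪ Finset.Ico (x + 1) (x + 1 + d) := by
    ext i
    simp only [Finset.mem_erase, Finset.mem_range, Finset.mem_Ico, Finset.mem_union]
    omega
  rw [he, Finset.prod_union, Finset.prod_Ico_eq_prod_range, Nat.add_sub_cancel_left]
  rw [Finset.disjoint_left]
  intro i hi hi'
  rw [Finset.mem_range] at hi
  rw [Finset.mem_Ico] at hi'
  omega

/-- The Lagrange coefficients at `0` for the nodes `(2l + 1)², (2l + 3)², …`. -/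
lemma prod_erase_odd_sq_div (l x d : ℕ) :
    ∏ b ∈ (Finset.range (x + 1 + d)).erase x, ((2 * l + 2 * b + 1 : ℚ) ^ 2 /
        ((2 * l + 2 * b + 1) ^ 2 - (2 * l + 2 * x + 1) ^ 2)) =
      (-1) ^ x * (((2 * l + 2 * (x + 1 + d)).factorial * l.factorial : ℚ) /
        ((2 * l).factorial * (l + (x + 1 + d)).factorial * 2 ^ (x + 1 + d))) ^ 2 *
      (2 * l + x).factorial /
      (4 ^ (x + d) * x.factorial * d.factorial * (2 * l + 2 * x + 1 + d).factorial *
        (2 * l + 2 * x + 1)) := by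
  have hne : (2 * l + 2 * x + 1 : ℚ) ≠ 0 := by positivity
  have hnum : ∏ b ∈ (Finset.range (x + 1 + d)).erase x, (2 * l + 2 * b + 1 : ℚ) =
      ((2 * l + 2 * (x + 1 + d)).factorial * l.factorial : ℚ) /
        ((2 * l).factorial * (l + (x + 1 + d)).factorial * 2 ^ (x + 1 + d)) /
        (2 * l + 2 * x + 1) := by
    rw [eq_div_iff hne, ← prod_range_odd,
      Finset.prod_erase_mul _ _ (Finset.mem_range.2 (by omega))]
  have hden : ∏ b ∈ (Finset.range (x + 1 + d)).erase x,
      ((2 * l + 2 * b + 1 : ℚ) ^ 2 - (2 * l + 2 * x + 1) ^ 2) =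
      (-1 : ℚ) ^ x * 4 ^ (x + d) * x.factorial * d.factorial *
        (2 * l + 2 * x + 1 + d).factorial / ((2 * l + x).factorial * (2 * l + 2 * x + 1)) := by
    rw [prod_range_erase]
    have h1 : ∏ i ∈ Finset.range x, ((2 * l + 2 * i + 1 : ℚ) ^ 2 - (2 * l + 2 * x + 1) ^ 2) =
        4 ^ x * ((-1) ^ x * x.factorial) *
          (((2 * l + x + x).factorial : ℚ) / (2 * l + x).factorial) := by
      rw [← prod_range_sub_self, ← prod_range_add_one_add]
      rw [show (4 : ℚ) ^ x = ∏ _i ∈ Finset.range x, (4 : ℚ) by simp,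
        ← Finset.prod_mul_distrib, ← Finset.prod_mul_distrib]
      refine Finset.prod_congr rfl fun i _ => ?_
      push_cast
      ring
    have h2 : ∏ i ∈ Finset.range d, ((2 * l + 2 * (x + 1 + i : ℕ) + 1 : ℚ) ^ 2 -
        (2 * l + 2 * x + 1) ^ 2) =
        4 ^ d * (((0 + d).factorial : ℚ) / Nat.factorial 0) *
          (((2 * l + 2 * x + 1 + d).factorial : ℚ) / (2 * l + 2 * x + 1).factorial) := by
      rw [← prod_range_add_one_add, ← prod_range_add_one_add]
      rw [show (4 : ℚ) ^ d = ∏ _i ∈ Finset.range d, (4 : ℚ) by simp,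
        ← Finset.prod_mul_distrib, ← Finset.prod_mul_distrib]
      refine Finset.prod_congr rfl fun i _ => ?_
      push_cast
      ring
    rw [h1, h2, show 2 * l + x + x = 2 * l + 2 * x by ring, Nat.factorial_succ (2 * l + 2 * x)]
    push_cast
    rw [zero_add, pow_add]
    field_simp
    simp
  rw [Finset.prod_div_distrib, Finset.prod_pow, hnum, hden]
  have hs : ((-1 : ℚ) ^ x) ^ 2 = 1 := by rw [← pow_mul, mul_comm, pow_mul]; simp
  field_simp
  rw [hs]

/-- The Lagrange coefficients at `0` for the nodes `(N + 1)², (N + 2)², …, l²`. -/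
lemma prod_Ico_sq_div (N q : ℕ) :
    ∏ i ∈ Finset.Ico (N + 1) (N + 1 + q), ((i : ℚ) ^ 2 / (i ^ 2 - (N + 1 + q : ℕ) ^ 2)) =
      (-1) ^ q * (((N + q).factorial : ℚ) / N.factorial) ^ 2 * (2 * N + 1 + q).factorial /
        (q.factorial * (2 * N + 1 + 2 * q).factorial) := by
  rw [Finset.prod_Ico_eq_prod_range, Nat.add_sub_cancel_left, Finset.prod_div_distrib]
  have h1 : ∏ i ∈ Finset.range q, ((N + 1 + i : ℕ) : ℚ) ^ 2 =
      (((N + q).factorial : ℚ) / N.factorial) ^ 2 := by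
    rw [Finset.prod_pow, ← prod_range_add_one_add]
    push_cast
    rfl
  have h2 : ∏ i ∈ Finset.range q, (((N + 1 + i : ℕ) : ℚ) ^ 2 - (N + 1 + q : ℕ) ^ 2) =
      ((-1) ^ q * q.factorial) *
        (((2 * N + 1 + q + q).factorial : ℚ) / (2 * N + 1 + q).factorial) := by
    rw [← prod_range_sub_self, ← prod_range_add_one_add, ← Finset.prod_mul_distrib]
    refine Finset.prod_congr rfl fun i _ => ?_
    push_cast
    ring
  rw [h1, h2, show 2 * N + 1 + q + q = 2 * N + 1 + 2 * q by ring]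
  have hs : ((-1 : ℚ) ^ q) ^ 2 = 1 := by rw [← pow_mul, mul_comm, pow_mul]; simp
  field_simp
  rw [hs]

/-! ### Divisibility by powers of p in the rationals -/

/-- The rational number `x` lies in `p ^ e ℤ_(p)`. -/
def PowDvd (p e : ℕ) (x : ℚ) : Prop :=
  padicNorm p x ≤ (p : ℚ) ^ (-(e : ℤ))

section PowDvd

variable {p e a b : ℕ} {x y : ℚ}

lemma powDvd_zero : PowDvd p e 0 := by
  rw [PowDvd, padicNorm.zero]
  positivity

lemma PowDvd.neg (hx : PowDvd p e x) : PowDvd p e (-x) := by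
  rwa [PowDvd, padicNorm.neg]

variable [hp : Fact p.Prime]

lemma PowDvd.ratModEq (h : PowDvd p e (x - y)) : RatModEq (p ^ e) x y := by
  rw [RatModEq, padicNorm.dvd_iff_norm_le]
  refine le_trans ?_ h
  have hq : ((x - y).num : ℚ) = (x - y) * (x - y).den := (Rat.mul_den_eq_num _).symm
  rw [hq, padicNorm.mul]
  exact mul_le_of_le_one_right (padicNorm.nonneg _) (padicNorm.of_nat _)

lemma PowDvd.add (hx : PowDvd p e x) (hy : PowDvd p e y) : PowDvd p e (x + y) :=
  padicNorm.nonarchimedean.trans (max_le hx hy)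

lemma PowDvd.sub (hx : PowDvd p e x) (hy : PowDvd p e y) : PowDvd p e (x - y) := by
  rw [sub_eq_add_neg]
  exact hx.add hy.neg

lemma PowDvd.sum {ι : Type*} {s : Finset ι} {f : ι → ℚ} (h : ∀ i ∈ s, PowDvd p e (f i)) :
    PowDvd p e (∑ i ∈ s, f i) :=
  Finset.sum_induction _ _ (fun _ _ => PowDvd.add) powDvd_zero h

lemma PowDvd.mul (hx : PowDvd p a x) (hy : PowDvd p b y) : PowDvd p (a + b) (x * y) := by
  have h0 : (p : ℚ) ≠ 0 := Nat.cast_ne_zero.2 hp.out.ne_zero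
  rw [PowDvd, padicNorm.mul, Nat.cast_add, neg_add, zpow_add₀ h0]
  exact mul_le_mul hx hy (padicNorm.nonneg _) (by positivity)

lemma PowDvd.mono (hx : PowDvd p a x) (h : e ≤ a) : PowDvd p e x := by
  refine le_trans hx (zpow_le_zpow_right₀ ?_ (by omega))
  exact_mod_cast hp.out.one_le

lemma powDvd_intCast {z : ℤ} (h : ((p ^ e : ℕ) : ℤ) ∣ z) : PowDvd p e z :=
  padicNorm.dvd_iff_norm_le.1 h

/-- A rational number that becomes a multiple of `p ^ a` after multiplication by an integer prime
to `p` and by an integer of valuation at most `a - e` is a multiple of `p ^ e`. -/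
lemma powDvd_of_mul_eq {u d : ℕ} {z : ℤ} (hu : ¬ p ∣ u) (hd : d ≠ 0)
    (hz : ((p ^ a : ℕ) : ℤ) ∣ z) (h : x * (u * d) = z) (hle : e + padicValNat p d ≤ a) :
    PowDvd p e x := by
  have hz' := powDvd_intCast hz
  have h0 : (p : ℚ) ≠ 0 := Nat.cast_ne_zero.2 hp.out.ne_zero
  have hd' : padicNorm p d = (p : ℚ) ^ (-(padicValNat p d : ℤ)) := by
    rw [padicNorm.eq_zpow_of_nonzero (Nat.cast_ne_zero.2 hd), padicValRat.of_nat]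
  rw [PowDvd, ← h, padicNorm.mul, padicNorm.mul, (padicNorm.nat_eq_one_iff u).2 hu, one_mul, hd',
    ← le_div_iff₀ (zpow_pos (by exact_mod_cast hp.out.pos) _), ← zpow_sub₀ h0] at hz'
  refine le_trans hz' (zpow_le_zpow_right₀ ?_ (by omega))
  exact_mod_cast hp.out.one_le

lemma PowDvd.one_mul_sub_one (hx : PowDvd p e (x - 1)) (hy : PowDvd p e (y - 1)) :
    PowDvd p e (x * y - 1) := by
  have h : x * y - 1 = (x - 1) * (y - 1) + (x - 1) + (y - 1) := by ring
  rw [h]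
  exact (((hx.mul hy).mono (by omega)).add hx).add hy

lemma PowDvd.prod_sub_one {ι : Type*} {s : Finset ι} {f : ι → ℚ}
    (h : ∀ i ∈ s, PowDvd p e (f i - 1)) : PowDvd p e (∏ i ∈ s, f i - 1) :=
  Finset.prod_induction _ (fun x => PowDvd p e (x - 1)) (fun _ _ => PowDvd.one_mul_sub_one)
    (by simpa using powDvd_zero) h

lemma PowDvd.inv_sub_one (he : e ≠ 0) (hx : PowDvd p e (x - 1)) : PowDvd p e (x⁻¹ - 1) := by
  have h1 : padicNorm p (x - 1) < 1 := by
    refine lt_of_le_of_lt hx (zpow_lt_one_of_neg₀ ?_ (by omega))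
    exact_mod_cast hp.out.one_lt
  have h2 : padicNorm p x = 1 := by
    have h := padicNorm.add_eq_max_of_ne (p := p) (q := x - 1) (r := 1)
      (by rw [padicNorm.one]; exact h1.ne)
    rwa [sub_add_cancel, padicNorm.one, max_eq_right h1.le] at h
  have hx0 : x ≠ 0 := fun h0 => by simp [h0] at h2
  have h3 : x⁻¹ - 1 = -(x - 1) / x := by
    field_simp
    ring
  rw [PowDvd, h3, padicNorm.div, h2, div_one]
  exact hx.neg

end PowDvd

/-! ### Carries and the valuation of central binomial coefficients -/

section Valuation

variable {p : ℕ}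

lemma three_mod_four_pow_odd (hp4 : p % 4 = 3) (j : ℕ) : p ^ (2 * j + 1) % 4 = 3 := by
  induction j with
  | zero => simpa using hp4
  | succ j ih =>
    rw [show 2 * (j + 1) + 1 = (2 * j + 1) + 1 + 1 by ring, pow_succ, pow_succ, Nat.mul_mod,
      Nat.mul_mod (p ^ _), ih, hp4]

lemma one_mod_four_pow_even (hp4 : p % 4 = 3) (j : ℕ) : p ^ (2 * j) % 4 = 1 := by
  have h := three_mod_four_pow_odd hp4 j
  rw [pow_succ, Nat.mul_mod, hp4] at h
  have := Nat.mod_lt (p ^ (2 * j)) (show 0 < 4 by norm_num)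
  interval_cases p ^ (2 * j) % 4 <;> simp_all

/-- In the addition `M + M` in base `p` there is a carry at the digit of index `2 j` whenever
`M ≡ -1/4` modulo `p ^ (2 j + 1)`. -/
lemma pow_odd_le_two_mul_mod (hp4 : p % 4 = 3) {j M : ℕ} (h : p ^ (2 * j + 1) ∣ 4 * M + 1) :
    p ^ (2 * j + 1) ≤ 2 * (M % p ^ (2 * j + 1)) := by
  have hP := three_mod_four_pow_odd hp4 j
  set P := p ^ (2 * j + 1)
  have h1 : P ∣ 4 * (M % P) + 1 := by
    have h2 : 4 * M + 1 = P * (4 * (M / P)) + (4 * (M % P) + 1) := by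
      have := Nat.div_add_mod M P
      linarith
    rw [h2] at h
    exact (Nat.dvd_add_right (Dvd.intro _ rfl)).1 h
  obtain ⟨c, hc⟩ := h1
  -- P ≡ 3 and P * c ≡ 1 mod 4 force c ≡ 3 mod 4.
  have hc3 : 3 ≤ c := by
    by_contra hlt
    have : c < 3 := by omega
    interval_cases c <;> omega
  have := Nat.mul_le_mul_left P hc3
  omega

variable [hp : Fact p.Prime]

/-- Kummer's theorem: the valuation counts the carries in M + M. -/
lemma padicValNat_centralBinom {b M : ℕ} (hb : 2 * M < b) :
    padicValNat p M.centralBinom =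
      ((Finset.Ico 1 b).filter fun i => p ^ i ≤ 2 * (M % p ^ i)).card := by
  rw [Nat.centralBinom, padicValNat_choose (b := b) (by omega)
    (lt_of_le_of_lt (Nat.log_le_self _ _) hb), show 2 * M - M = M by omega]
  simp only [two_mul]

/-- Every odd exponent up to h gives a carry, and there are (h + 1) / 2 of them. -/
lemma le_padicValNat_centralBinom (hp4 : p % 4 = 3) {h M : ℕ} (hM : p ^ h ∣ 4 * M + 1) :
    (h + 1) / 2 ≤ padicValNat p M.centralBinom := by
  rw [padicValNat_centralBinom (show 2 * M < 2 * M + h + 1 by omega)]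
  have hinj : Function.Injective fun j => 2 * j + 1 := fun a b hab => by simpa using hab
  calc (h + 1) / 2 = ((Finset.range ((h + 1) / 2)).image fun j => 2 * j + 1).card := by
        rw [Finset.card_image_of_injective _ hinj, Finset.card_range]
    _ ≤ _ := by
        refine Finset.card_le_card fun i hi => ?_
        obtain ⟨j, hj, rfl⟩ := Finset.mem_image.1 hi
        rw [Finset.mem_range] at hj
        rw [Finset.mem_filter, Finset.mem_Ico]
        exact ⟨by omega, pow_odd_le_two_mul_mod hp4 ((pow_dvd_pow p (by omega)).trans hM)⟩

/-- The size condition on M adds a carry at the exponent 2r, which is even and so distinct from the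
odd exponents already counted. -/
lemma succ_le_padicValNat_centralBinom (hp4 : p % 4 = 3) {h r M : ℕ} (hr : 1 ≤ r)
    (hM : p ^ h ∣ 4 * M + 1) (hhr : h ≤ 2 * r) (hlt : M < p ^ (2 * r)) (hle : p ^ (2 * r) ≤ 2 * M) :
    (h + 1) / 2 + 1 ≤ padicValNat p M.centralBinom := by
  rw [padicValNat_centralBinom (show 2 * M < 2 * M + 2 * r + 1 by omega)]
  have hinj : Function.Injective fun j => 2 * j + 1 := fun a b hab => by simpa using hab
  have hnot : 2 * r ∉ (Finset.range ((h + 1) / 2)).image fun j => 2 * j + 1 := by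
    rw [Finset.mem_image]
    rintro ⟨j, _, hj⟩
    omega
  calc (h + 1) / 2 + 1 =
        (insert (2 * r) ((Finset.range ((h + 1) / 2)).image fun j => 2 * j + 1)).card := by
        rw [Finset.card_insert_of_notMem hnot, Finset.card_image_of_injective _ hinj,
          Finset.card_range]
    _ ≤ _ := by
        refine Finset.card_le_card fun i hi => ?_
        rw [Finset.mem_filter, Finset.mem_Ico]
        rcases Finset.mem_insert.1 hi with rfl | hi
        · exact ⟨by omega, by rwa [Nat.mod_eq_of_lt hlt]⟩
        · obtain ⟨j, hj, rfl⟩ := Finset.mem_image.1 hi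
          rw [Finset.mem_range] at hj
          exact ⟨by omega, pow_odd_le_two_mul_mod hp4 ((pow_dvd_pow p (by omega)).trans hM)⟩

lemma padicValNat_lt_of_lt_pow {m k : ℕ} (hm : m ≠ 0) (hlt : m < p ^ k) : padicValNat p m < k := by
  have h := Nat.le_of_dvd (Nat.pos_of_ne_zero hm) (pow_padicValNat_dvd (p := p) (n := m))
  exact (Nat.pow_lt_pow_iff_right hp.out.one_lt).1 (h.trans_lt hlt)

lemma not_dvd_four_pow (hp4 : p % 4 = 3) (k : ℕ) : ¬ p ∣ 4 ^ k := by
  intro h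
  have h4 : p ∣ 2 := by
    rw [show 4 ^ k = 2 ^ (2 * k) by rw [pow_mul]; rfl] at h
    exact hp.out.dvd_of_dvd_pow h
  have := Nat.le_of_dvd (by norm_num) h4
  omega

end Valuation

/-! ### The first half of the sum -/

lemma watson_odd_mul_eq_zero {l j : ℕ} (hj : j % 2 = 1) (c : ℚ) :
    (∑ t ∈ Finset.range (j + 1), watsonTerm l j t) * c = 0 := by
  obtain ⟨M, rfl⟩ : ∃ M, j = 2 * M + 1 := ⟨j / 2, by omega⟩
  rw [sum_watsonTerm_odd, zero_mul]

lemma sum_shiftedTerm (l D : ℕ) :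
    ∑ t ∈ Finset.range D, shiftedTerm l t =
    ∑ j ∈ Finset.range D, (∑ t ∈ Finset.range (j + 1), watsonTerm l j t) *
      ∏ b ∈ (Finset.range D).erase j, ((2 * l + 2 * b + 1 : ℚ) ^ 2 /
        ((2 * l + 2 * b + 1) ^ 2 - (2 * l + 2 * j + 1) ^ 2)) :=
  sum_cube_eq_interpolate l D

lemma sum_range_halfRatio_cube (D : ℕ) :
    ∑ k ∈ Finset.range D, halfRatio k ^ 3 =
    ∑ j ∈ Finset.range D, (∑ t ∈ Finset.range (j + 1), watsonTerm 0 j t) *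
      ∏ b ∈ (Finset.range D).erase j, ((2 * b + 1 : ℚ) ^ 2 /
        ((2 * b + 1) ^ 2 - (2 * j + 1) ^ 2)) := by
  simp_rw [← shiftedTerm_zero_left]
  simpa using sum_shiftedTerm 0 D

lemma sum_watsonTerm_zero_even (M : ℕ) :
    ∑ t ∈ Finset.range (2 * M + 1), watsonTerm 0 (2 * M) t = halfRatio M ^ 2 := by
  rw [sum_watsonTerm_even, halfRatio_eq_prod]
  simp

/-- Clears denominators to expose the valuation. The square of 4M + 2d + 3, later equal to n², is
the numerator at the last index b = 2M + d + 1. -/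
lemma halfRatio_sq_mul_coeff (M d : ℕ) :
    halfRatio M ^ 2 * (∏ b ∈ (Finset.range (2 * M + 1 + (d + 1))).erase (2 * M),
      ((2 * b + 1 : ℚ) ^ 2 / ((2 * b + 1) ^ 2 - (2 * (2 * M : ℕ) + 1) ^ 2))) *
      ((4 ^ (6 * M + 2 * d + 2) : ℕ) * ((4 * M + 1) * (d + 1) : ℕ)) =
    (((4 * M + 2 * d + 3) ^ 2 * (2 * M + d + 1).centralBinom *
      (2 * (2 * M + d + 1)).choose d * M.centralBinom ^ 2 : ℕ) : ℤ) := by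
  have h := prod_erase_odd_sq_div 0 (2 * M) (d + 1)
  simp only [Nat.cast_zero, mul_zero, zero_add, Nat.factorial_zero, Nat.cast_one, one_mul,
    mul_one] at h
  rw [h, halfRatio_eq_factorial]
  push_cast
  have e1 : (((2 * M + d + 1).centralBinom : ℕ) : ℚ) =
      ((2 * (2 * M + d + 1)).factorial : ℚ) / ((2 * M + d + 1).factorial) ^ 2 := by
    rw [Nat.centralBinom, Nat.cast_choose ℚ (by omega),
      show 2 * (2 * M + d + 1) - (2 * M + d + 1) = 2 * M + d + 1 by omega, sq]
  have e2 : (((2 * (2 * M + d + 1)).choose d : ℕ) : ℚ) =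
      ((2 * (2 * M + d + 1)).factorial : ℚ) /
        (d.factorial * (4 * M + d + 2).factorial) := by
    rw [Nat.cast_choose ℚ (by omega),
      show 2 * (2 * M + d + 1) - d = 4 * M + d + 2 by omega]
  have e3 : ((M.centralBinom : ℕ) : ℚ) = ((2 * M).factorial : ℚ) / (M.factorial) ^ 2 := by
    rw [Nat.centralBinom, Nat.cast_choose ℚ (by omega), show 2 * M - M = M by omega, sq]
  have e4 : ((2 * (2 * M + 1 + (d + 1))).factorial : ℚ) =
      2 * (2 * M + d + 2) * ((4 * M + 2 * d + 3) * (2 * (2 * M + d + 1)).factorial) := by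
    rw [show 2 * (2 * M + 1 + (d + 1)) = 2 * (2 * M + d + 1) + 1 + 1 by ring,
      Nat.factorial_succ, Nat.factorial_succ]
    push_cast
    ring
  have e5 : ((2 * M + 1 + (d + 1)).factorial : ℚ) =
      (2 * M + d + 2) * (2 * M + d + 1).factorial := by
    rw [show 2 * M + 1 + (d + 1) = 2 * M + d + 1 + 1 by ring, Nat.factorial_succ]
    push_cast
    ring
  have e6 : ((2 * (2 * M) + 1 + (d + 1)).factorial : ℚ) = (4 * M + d + 2).factorial := by
    rw [show 2 * (2 * M) + 1 + (d + 1) = 4 * M + d + 2 by ring]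
  have e7 : ((d + 1).factorial : ℚ) = (d + 1) * d.factorial := by
    rw [Nat.factorial_succ]
    push_cast
    ring
  have e8 : ((-1 : ℚ) ^ (2 * M)) = 1 := by simp
  rw [e1, e2, e3, e4, e5, e6, e7, e8]
  have e9 : (2 : ℚ) ^ (2 * M + 1 + (d + 1)) = 4 * 2 ^ (2 * M) * 2 ^ d := by ring
  have e4pow : ∀ k : ℕ, (4 : ℚ) ^ k = (2 ^ k) ^ 2 := fun k => by
    rw [← pow_mul, mul_comm, pow_mul]
    norm_num
  have e10 : (4 : ℚ) ^ M = 2 ^ (2 * M) := by rw [e4pow, ← pow_mul, mul_comm]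
  have e11 : (4 : ℚ) ^ (2 * M + (d + 1)) = 4 * (2 ^ (2 * M)) ^ 2 * (2 ^ d) ^ 2 := by
    rw [e4pow]
    ring
  have e12 : (4 : ℚ) ^ (6 * M + 2 * d + 2) = 16 * (2 ^ (2 * M)) ^ 6 * (2 ^ d) ^ 4 := by
    rw [e4pow]
    ring
  rw [e9, e10, e11, e12]
  field_simp
  ring

section

variable {p : ℕ} [hp : Fact p.Prime]

/-- With g the valuation of 4M + 1, the denominators cost at most 2g while n² and the carries supply
4r + 2⌊(g+1)/2⌋. As g ≤ 2r - 1, at least 2r + 2 remains; equality at g = 2r - 1 relies on that g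
being odd. -/
lemma powDvd_low_term (hp4 : p % 4 = 3) {r M d : ℕ}
    (hn : p ^ (2 * r) = 4 * M + 2 * d + 3) :
    PowDvd p (2 * r + 2)
      (halfRatio M ^ 2 * ∏ b ∈ (Finset.range (2 * M + 1 + (d + 1))).erase (2 * M),
        ((2 * b + 1 : ℚ) ^ 2 / ((2 * b + 1) ^ 2 - (2 * (2 * M : ℕ) + 1) ^ 2))) := by
  set g := padicValNat p (4 * M + 1) with hg
  have hg1 : p ^ g ∣ 4 * M + 1 := pow_padicValNat_dvd
  have hg2 : g < 2 * r := padicValNat_lt_of_lt_pow (by omega) (by omega)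
  have hd2 : padicValNat p (d + 1) < 2 * r := padicValNat_lt_of_lt_pow (by omega) (by omega)
  -- 4M + 1 + 2(d + 1) = n, so a power of p below n dividing d + 1 divides 4M + 1.
  have hdg : padicValNat p (d + 1) ≤ g := by
    rw [hg, ← padicValNat_dvd_iff_le (by omega)]
    have h1 : p ^ padicValNat p (d + 1) ∣ 4 * M + 1 + 2 * (d + 1) := by
      rw [show 4 * M + 1 + 2 * (d + 1) = p ^ (2 * r) by omega]
      exact pow_dvd_pow p hd2.le
    exact (Nat.dvd_add_left (pow_padicValNat_dvd.mul_left 2)).1 h1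
  have hc := le_padicValNat_centralBinom hp4 hg1
  refine powDvd_of_mul_eq (a := 4 * r + 2 * padicValNat p M.centralBinom)
    (not_dvd_four_pow hp4 _) (by positivity) ?_ (halfRatio_sq_mul_coeff M d) ?_
  · rw [Int.natCast_dvd_natCast, pow_add, ← hn, ← pow_mul]
    refine mul_dvd_mul ?_ ?_
    · exact Dvd.dvd.mul_right (Dvd.dvd.mul_right (pow_dvd_pow p (by omega)) _) _
    · rw [mul_comm, pow_mul]
      exact pow_dvd_pow_of_dvd pow_padicValNat_dvd 2
  · rw [padicValNat.mul (by omega) (by omega), ← hg]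
    omega

/-- Since 0 < q < n, the valuation of q is below 2r, so p divides n / q. -/
lemma powDvd_one_sub_sq_div_sub_one {r q : ℕ} (hq : q ≠ 0) (hlt : q < p ^ (2 * r)) :
    PowDvd p 2 (1 - ((p ^ (2 * r) : ℕ) : ℚ) ^ 2 / (q : ℚ) ^ 2 - 1) := by
  have hq0 : (q : ℚ) ≠ 0 := Nat.cast_ne_zero.2 hq
  have h1 : PowDvd p 1 (((p ^ (2 * r) : ℕ) : ℚ) / q) := by
    refine powDvd_of_mul_eq (u := 1) (d := q) (a := 2 * r) (z := (p ^ (2 * r) : ℕ))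
      hp.out.not_dvd_one hq dvd_rfl ?_ ?_
    · push_cast
      field_simp
    · have := padicValNat_lt_of_lt_pow hq hlt
      omega
  have h2 : 1 - ((p ^ (2 * r) : ℕ) : ℚ) ^ 2 / (q : ℚ) ^ 2 - 1 =
      -((((p ^ (2 * r) : ℕ) : ℚ) / q) * (((p ^ (2 * r) : ℕ) : ℚ) / q)) := by
    field_simp
    ring
  rw [h2]
  exact (h1.mul h1).neg

lemma powDvd_top_coeff_sub_one {r M : ℕ} (hn : p ^ (2 * r) = 4 * M + 1) :
    PowDvd p 2 ((∏ b ∈ (Finset.range (2 * M + 1)).erase (2 * M),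
        ((2 * b + 1 : ℚ) ^ 2 / ((2 * b + 1) ^ 2 - (2 * (2 * M : ℕ) + 1) ^ 2))) - 1) := by
  refine PowDvd.prod_sub_one fun b hb => ?_
  rw [Finset.mem_erase, Finset.mem_range] at hb
  have h := (powDvd_one_sub_sq_div_sub_one (p := p) (r := r) (q := 2 * b + 1) (by omega)
    (by omega)).inv_sub_one two_ne_zero
  convert h using 2
  rw [hn]
  push_cast
  have h0 : (2 * b + 1 : ℚ) ^ 2 ≠ 0 := by positivity
  rw [one_sub_div h0, inv_div]
  ring

lemma powDvd_halfRatio_sq (hp4 : p % 4 = 3) {r M : ℕ} (hn : p ^ (2 * r) = 4 * M + 1) :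
    PowDvd p (2 * r) (halfRatio M ^ 2) := by
  have hc := le_padicValNat_centralBinom (p := p) (h := 2 * r) (M := M) hp4 (by rw [hn])
  have hc' : r ≤ padicValNat p M.centralBinom := by omega
  have h1 : PowDvd p r (halfRatio M) := by
    refine powDvd_of_mul_eq (u := 4 ^ M) (d := 1) (a := padicValNat p M.centralBinom)
      (z := (M.centralBinom : ℕ)) (not_dvd_four_pow hp4 _) one_ne_zero
      (Int.natCast_dvd_natCast.2 pow_padicValNat_dvd) ?_ ?_
    · rw [halfRatio]
      push_cast
      field_simp
    · simpa using hc'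
  rw [sq, two_mul]
  exact h1.mul h1

end

/-- The quotient of rising factorials on the right-hand side, compared with `halfRatio M ^ 2`. -/
lemma mul_risingFactorial_div_eq (M : ℕ) :
    (4 * M + 1 : ℚ) * (risingFactorial (3 / 4) (2 * M) / risingFactorial (5 / 4) (2 * M)) =
      halfRatio M ^ 2 * ∏ j ∈ Finset.range M,
        ((1 - (4 * M + 1 : ℚ) ^ 2 / ((4 * j + 2 : ℕ) : ℚ) ^ 2) *
          (1 - (4 * M + 1 : ℚ) ^ 2 / ((4 * j + 4 : ℕ) : ℚ) ^ 2)⁻¹) := by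
  -- Reversing the lower half pairs n - (4j+2) with n + (4j+2), where n = 4M + 1, so that
  -- differences of squares appear.
  have hsplit : ∀ a : ℚ, risingFactorial a (2 * M) =
      (∏ j ∈ Finset.range M, (a + (M - 1 - j : ℕ))) * ∏ j ∈ Finset.range M, (a + (M + j : ℕ)) := by
    intro a
    rw [Finset.prod_range_reflect (fun i : ℕ => a + (i : ℚ)), two_mul, risingFactorial,
      Finset.prod_range_add]
  -- The factor 4M + 1 shifts the lower denominators from 5/4 to 1/4, where they pair as n - (4j+4)
  -- and n + (4j+4).
  have h5 : (4 * M + 1 : ℚ) * ∏ j ∈ Finset.range M, ((1 / 4 : ℚ) + (M - 1 - j : ℕ)) =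
      ∏ j ∈ Finset.range M, ((5 / 4 : ℚ) + (M - 1 - j : ℕ)) := by
    rw [Finset.prod_range_reflect (fun i : ℕ => (1 / 4 : ℚ) + (i : ℚ)),
      Finset.prod_range_reflect (fun i : ℕ => (5 / 4 : ℚ) + (i : ℚ))]
    have h := Finset.prod_range_succ (fun i : ℕ => (1 / 4 : ℚ) + (i : ℚ)) M
    rw [Finset.prod_range_succ'] at h
    have h' : ∏ i ∈ Finset.range M, ((1 / 4 : ℚ) + ((i + 1 : ℕ) : ℚ)) =
        ∏ i ∈ Finset.range M, ((5 / 4 : ℚ) + (i : ℚ)) :=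
      Finset.prod_congr rfl fun i _ => by push_cast; ring
    rw [h'] at h
    push_cast at h
    linarith
  have hpos : (0 : ℚ) < ∏ j ∈ Finset.range M, ((1 / 4 : ℚ) + (M - 1 - j : ℕ)) :=
    Finset.prod_pos fun j _ => by positivity
  have hpos' : (0 : ℚ) < ∏ j ∈ Finset.range M, ((5 / 4 : ℚ) + (M + j : ℕ)) :=
    Finset.prod_pos fun j _ => by positivity
  have h1 : (4 * M + 1 : ℚ) * (risingFactorial (3 / 4) (2 * M) / risingFactorial (5 / 4) (2 * M)) =
      (∏ j ∈ Finset.range M, ((3 / 4 : ℚ) + (M - 1 - j : ℕ))) *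
        (∏ j ∈ Finset.range M, ((3 / 4 : ℚ) + (M + j : ℕ))) /
      ((∏ j ∈ Finset.range M, ((1 / 4 : ℚ) + (M - 1 - j : ℕ))) *
        ∏ j ∈ Finset.range M, ((5 / 4 : ℚ) + (M + j : ℕ))) := by
    rw [hsplit, hsplit, ← h5]
    field_simp
  rw [h1, halfRatio_eq_prod, ← Finset.prod_pow, ← Finset.prod_mul_distrib,
    ← Finset.prod_mul_distrib, ← Finset.prod_mul_distrib, ← Finset.prod_div_distrib]
  refine Finset.prod_congr rfl fun j hj => ?_
  rw [Finset.mem_range] at hj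
  obtain ⟨c, rfl⟩ : ∃ c, M = j + 1 + c := ⟨M - (j + 1), by omega⟩
  rw [show j + 1 + c - 1 - j = c by omega]
  have h2 : ((4 * j + 2 : ℕ) : ℚ) ^ 2 ≠ 0 := by positivity
  have h4 : ((4 * j + 4 : ℕ) : ℚ) ^ 2 ≠ 0 := by positivity
  rw [one_sub_div h2, one_sub_div h4, inv_div]
  have e2 : ((4 * j + 2 : ℕ) : ℚ) ^ 2 - (4 * (j + 1 + c : ℕ) + 1) ^ 2 =
      -((4 * c + 3) * (8 * j + 4 * c + 7)) := by
    push_cast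
    ring
  have e4 : ((4 * j + 4 : ℕ) : ℚ) ^ 2 - (4 * (j + 1 + c : ℕ) + 1) ^ 2 =
      -((4 * c + 1) * (8 * j + 4 * c + 9)) := by
    push_cast
    ring
  rw [e2, e4]
  push_cast
  have f1 : (5 / 4 + (j + 1 + c + j) : ℚ) = (8 * j + 4 * c + 9) / 4 := by ring
  have f2 : (1 / 4 + c : ℚ) = (4 * c + 1) / 4 := by ring
  rw [f1, f2]
  field_simp
  ring

section

variable {p : ℕ} [hp : Fact p.Prime]

lemma powDvd_target_sub (hp4 : p % 4 = 3) {r M : ℕ}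
    (hn : p ^ (2 * r) = 4 * M + 1) :
    PowDvd p (2 * r + 2) (∑ k ∈ Finset.range (2 * M + 1), halfRatio k ^ 3 -
      (p : ℚ) ^ (2 * r) *
        (risingFactorial (3 / 4) (2 * M) / risingFactorial (5 / 4) (2 * M))) := by
  have hn' : (p : ℚ) ^ (2 * r) = 4 * M + 1 := by exact_mod_cast hn
  rw [hn', mul_risingFactorial_div_eq, sum_range_halfRatio_cube, Finset.sum_range_succ,
    sum_watsonTerm_zero_even, add_sub_assoc, ← mul_sub]
  refine PowDvd.add (PowDvd.sum fun j hj => ?_) ((powDvd_halfRatio_sq hp4 hn).mul ?_)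
  · rw [Finset.mem_range] at hj
    rcases Nat.even_or_odd' j with ⟨i, rfl | rfl⟩
    · obtain ⟨d, hd⟩ : ∃ d, 2 * M = 2 * i + (d + 1) := ⟨2 * M - 2 * i - 1, by omega⟩
      rw [sum_watsonTerm_zero_even, show 2 * M + 1 = 2 * i + 1 + (d + 1) by omega]
      exact powDvd_low_term hp4 (by omega)
    · rw [watson_odd_mul_eq_zero (by omega)]
      exact powDvd_zero
  -- Both cofactors of `halfRatio M ^ 2` are 1 modulo p², so their difference supplies the last two
  -- powers of p.
  · have h1 := powDvd_top_coeff_sub_one (p := p) hn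
    have h2 : PowDvd p 2 ((∏ j ∈ Finset.range M,
        ((1 - (4 * M + 1 : ℚ) ^ 2 / ((4 * j + 2 : ℕ) : ℚ) ^ 2) *
          (1 - (4 * M + 1 : ℚ) ^ 2 / ((4 * j + 4 : ℕ) : ℚ) ^ 2)⁻¹)) - 1) := by
      refine PowDvd.prod_sub_one fun j hj => ?_
      rw [Finset.mem_range] at hj
      have hn'' : (4 * M + 1 : ℚ) = ((p ^ (2 * r) : ℕ) : ℚ) := by rw [hn]; push_cast; rfl
      rw [hn'']
      refine PowDvd.one_mul_sub_one (powDvd_one_sub_sq_div_sub_one (by omega) (by omega))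
        (PowDvd.inv_sub_one two_ne_zero (powDvd_one_sub_sq_div_sub_one (by omega) (by omega)))
    have h := h1.sub h2
    rwa [sub_sub_sub_cancel_right] at h

end

/-! ### The second half of the sum -/

lemma sum_watsonTerm_even_eq_factorial (l M : ℕ) :
    ∑ t ∈ Finset.range (2 * M + 1), watsonTerm l (2 * M) t =
      (((2 * M).factorial * l.factorial : ℚ) /
        (M.factorial * (l + M).factorial * 4 ^ M)) ^ 2 := by
  have h1 := prod_range_odd 0 M
  have h2 := prod_range_add_one_add l M
  simp only [Nat.cast_zero, mul_zero, zero_add, Nat.factorial_zero, Nat.cast_one, one_mul,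
    mul_one] at h1
  have h3 : ∏ i ∈ Finset.range M, (2 * l + 2 + 2 * i : ℚ) =
      2 ^ M * (((l + M).factorial : ℚ) / l.factorial) := by
    rw [← h2, show (2 : ℚ) ^ M = ∏ _i ∈ Finset.range M, (2 : ℚ) by simp,
      ← Finset.prod_mul_distrib]
    exact Finset.prod_congr rfl fun i _ => by ring
  have h4 : (4 : ℚ) ^ M = 2 ^ M * 2 ^ M := by rw [← mul_pow]; norm_num
  rw [sum_watsonTerm_even, Finset.prod_div_distrib, h1, h3, h4]
  congr 1
  field_simp

/-- The factor n² is released by (2n)! = 2n (2n-1)! and n! = n (2N)!; the rest is arranged into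
binomial coefficients, leaving only l (2l+4M+1) and a power of 4 as denominators. -/
lemma tail_term_eq (q M d : ℕ) {N l n : ℕ} (hl : l = N + 1 + q) (hn : n = 2 * N + 1)
    (hd : n = l + (2 * M + 1 + d)) :
    halfRatio l ^ 3 * (∏ i ∈ Finset.Ico (N + 1) l, ((i : ℚ) ^ 2 / (i ^ 2 - l ^ 2))) *
      ((∑ t ∈ Finset.range (2 * M + 1), watsonTerm l (2 * M) t) *
      ∏ b ∈ (Finset.range (2 * M + 1 + d)).erase (2 * M), ((2 * l + 2 * b + 1 : ℚ) ^ 2 /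
        ((2 * l + 2 * b + 1) ^ 2 - (2 * l + 2 * (2 * M : ℕ) + 1) ^ 2))) *
      ((4 ^ (3 * l + 6 * M + 1 + 2 * d) : ℕ) * (l * (2 * l + 4 * M + 1) : ℕ)) =
    (((-1) ^ q * (n ^ 2 * (M.centralBinom * (l + M).centralBinom) * (4 * (l + N).choose n *
      N.centralBinom * n.centralBinom * (2 * n - 1).choose d) : ℕ) : ℤ) : ℚ) := by
  have c1 : ((M.centralBinom : ℕ) : ℚ) = ((2 * M).factorial : ℚ) / (M.factorial) ^ 2 := by
    rw [Nat.centralBinom, Nat.cast_choose ℚ (by omega), show 2 * M - M = M by omega, sq]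
  have c2 : (((l + M).centralBinom : ℕ) : ℚ) =
      ((2 * l + 2 * M).factorial : ℚ) / ((l + M).factorial) ^ 2 := by
    rw [Nat.centralBinom, Nat.cast_choose ℚ (by omega),
      show 2 * (l + M) - (l + M) = l + M by omega, sq, mul_add]
  have c3 : (((l + N).choose n : ℕ) : ℚ) =
      ((l + N).factorial : ℚ) / (n.factorial * q.factorial) := by
    rw [Nat.cast_choose ℚ (by omega), show l + N - n = q by omega]
  have c4 : ((N.centralBinom : ℕ) : ℚ) = (n.factorial : ℚ) / (n * N.factorial ^ 2) := by
    rw [Nat.centralBinom, Nat.cast_choose ℚ (by omega), show 2 * N - N = N by omega, hn,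
      Nat.factorial_succ]
    push_cast
    field_simp
  have hn0 : 0 < n := by omega
  have hl0 : 0 < l := by omega
  have hnf : ((2 * n).factorial : ℚ) = 2 * n * (2 * n - 1).factorial := by
    obtain ⟨k, rfl⟩ : ∃ k, n = k + 1 := ⟨n - 1, by omega⟩
    rw [show 2 * (k + 1) - 1 = 2 * k + 1 by omega, show 2 * (k + 1) = 2 * k + 1 + 1 by ring,
      Nat.factorial_succ]
    push_cast
    ring
  have c5 : ((n.centralBinom : ℕ) : ℚ) = ((2 * n).factorial : ℚ) / (n.factorial) ^ 2 := by
    rw [Nat.centralBinom, Nat.cast_choose ℚ (by omega), show 2 * n - n = n by omega, sq]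
  have c6 : (((2 * n - 1).choose d : ℕ) : ℚ) =
      ((2 * n - 1).factorial : ℚ) / (d.factorial * (2 * l + 4 * M + 1 + d).factorial) := by
    rw [Nat.cast_choose ℚ (by omega), show 2 * n - 1 - d = 2 * l + 4 * M + 1 + d by omega]
  have hI : ∏ i ∈ Finset.Ico (N + 1) l, ((i : ℚ) ^ 2 / (i ^ 2 - l ^ 2)) =
      (-1) ^ q * ((l.factorial : ℚ) / (l * N.factorial)) ^ 2 * (l + N).factorial /
        (q.factorial * ((2 * l).factorial / (2 * l))) := by
    rw [hl, prod_Ico_sq_div]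
    have g1 : ((N + 1 + q).factorial : ℚ) = (N + 1 + q : ℕ) * (N + q).factorial := by
      rw [show N + 1 + q = N + q + 1 by ring, Nat.factorial_succ]
      push_cast
      ring
    have g2 : ((2 * (N + 1 + q)).factorial : ℚ) =
        2 * (N + 1 + q : ℕ) * (2 * N + 1 + 2 * q).factorial := by
      rw [show 2 * (N + 1 + q) = 2 * N + 1 + 2 * q + 1 by ring, Nat.factorial_succ]
      push_cast
      ring
    rw [g1, g2, show N + 1 + q + N = 2 * N + 1 + q by ring]
    field_simp
  have hC := prod_erase_odd_sq_div l (2 * M) d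
  rw [← hd, show 2 * l + 2 * (2 * M) + 1 + d = 2 * l + 4 * M + 1 + d by ring,
    show 2 * l + 2 * (2 * M + 1 + d) = 2 * n by omega] at hC
  rw [hC, hI, sum_watsonTerm_even_eq_factorial, halfRatio_eq_factorial]
  have e4pow : ∀ k : ℕ, (4 : ℚ) ^ k = (2 ^ k) ^ 2 := fun k => by
    rw [← pow_mul, mul_comm, pow_mul]
    norm_num
  have e1 : (2 : ℚ) ^ (2 * M + 1 + d) = 2 * (2 ^ M) ^ 2 * 2 ^ d := by ring
  have e2 : (4 : ℚ) ^ (2 * M + d) = (2 ^ M) ^ 4 * (2 ^ d) ^ 2 := by rw [e4pow]; ring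
  have e3 : (4 : ℚ) ^ (3 * l + 6 * M + 1 + 2 * d) =
      4 * (2 ^ l) ^ 6 * (2 ^ M) ^ 12 * (2 ^ d) ^ 4 := by rw [e4pow]; ring
  push_cast
  have e5 : ((-1 : ℚ) ^ (2 * M)) = 1 := by simp
  rw [c1, c2, c3, c4, c5, c6, hnf, e1, e2, e3, e4pow l, e4pow M, e5]
  have hn0' : (n : ℚ) ≠ 0 := by positivity
  have hl0' : (l : ℚ) ≠ 0 := by positivity
  field_simp
  ring

section

variable {p : ℕ} [hp : Fact p.Prime]

/-- Let h = min(e, g). The denominators cost e + g ≤ h + 2r - 1, while n² and the carries supply at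
least 4r + 2⌊(h+1)/2⌋ + 1, leaving at least 2r + 2. -/
lemma powDvd_tail_term (hp4 : p % 4 = 3) {r q M d N l : ℕ} (hr : 1 ≤ r) (hl : l = N + 1 + q)
    (hn : p ^ (2 * r) = 2 * N + 1) (hd : 2 * N + 1 = l + (2 * M + 1 + d)) :
    PowDvd p (2 * r + 2)
      (halfRatio l ^ 3 * (∏ i ∈ Finset.Ico (N + 1) l, ((i : ℚ) ^ 2 / (i ^ 2 - l ^ 2))) *
      ((∑ t ∈ Finset.range (2 * M + 1), watsonTerm l (2 * M) t) *
      ∏ b ∈ (Finset.range (2 * M + 1 + d)).erase (2 * M), ((2 * l + 2 * b + 1 : ℚ) ^ 2 /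
        ((2 * l + 2 * b + 1) ^ 2 - (2 * l + 2 * (2 * M : ℕ) + 1) ^ 2)))) := by
  set e := padicValNat p l with he
  set g := padicValNat p (2 * l + 4 * M + 1) with hg
  have he1 : p ^ e ∣ l := pow_padicValNat_dvd
  have hg1 : p ^ g ∣ 2 * l + 4 * M + 1 := pow_padicValNat_dvd
  have he2 : e < 2 * r := padicValNat_lt_of_lt_pow (by omega) (by omega)
  -- 2l + 4M + 1 = 2n - 1 - 2d lies strictly between n and 2n, so n does not divide it.
  have hg2 : g < 2 * r := by
    by_contra hlt
    obtain ⟨c, hc⟩ := (pow_dvd_pow p (not_lt.1 hlt)).trans hg1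
    rw [hn] at hc
    have h1 : 1 < c := by
      by_contra h
      have := Nat.mul_le_mul_left (2 * N + 1) (not_lt.1 h)
      omega
    have := Nat.mul_le_mul_left (2 * N + 1) (Nat.succ_le_of_lt h1)
    omega
  have hhl : p ^ min e g ∣ 2 * l := ((pow_dvd_pow p (min_le_left _ _)).trans he1).mul_left 2
  have hM : p ^ min e g ∣ 4 * M + 1 := by
    have h := (pow_dvd_pow p (min_le_right e g)).trans hg1
    rw [add_assoc] at h
    exact (Nat.dvd_add_right hhl).1 h
  have hs : p ^ min e g ∣ 4 * (l + M) + 1 := by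
    rw [show 4 * (l + M) + 1 = 2 * l + (2 * l + (4 * M + 1)) by ring]
    exact dvd_add hhl (dvd_add hhl hM)
  have h1 := le_padicValNat_centralBinom hp4 hM
  -- The leading carry occurs because l + M < n ≤ 2(l + M), as l > N.
  have h2 := succ_le_padicValNat_centralBinom hp4 hr hs (by omega) (by omega) (by omega)
  refine powDvd_of_mul_eq
    (a := 4 * r + (padicValNat p M.centralBinom + padicValNat p (l + M).centralBinom))
    (not_dvd_four_pow hp4 _) (mul_ne_zero (by omega) (by omega)) ?_
    (tail_term_eq q M d hl rfl hd) ?_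
  · refine Dvd.dvd.mul_left (Int.natCast_dvd_natCast.2 (Dvd.dvd.mul_right ?_ _)) _
    rw [pow_add, ← hn, ← pow_mul, pow_add]
    exact mul_dvd_mul (pow_dvd_pow p (by omega)) (mul_dvd_mul pow_padicValNat_dvd
      pow_padicValNat_dvd)
  · rw [padicValNat.mul (by omega) (by omega), ← he, ← hg]
    omega

lemma powDvd_tail (hp4 : p % 4 = 3) {r N : ℕ} (hr : 1 ≤ r) (hn : p ^ (2 * r) = 2 * N + 1) :
    PowDvd p (2 * r + 2) (∑ k ∈ Finset.Ico (N + 1) (2 * N + 1), halfRatio k ^ 3) := by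
  rw [sum_Ico_halfRatio_cube]
  refine PowDvd.sum fun l hl => ?_
  rw [Finset.mem_Ico] at hl
  rw [sum_shiftedTerm, Finset.mul_sum]
  refine PowDvd.sum fun j hj => ?_
  rw [Finset.mem_range] at hj
  rcases Nat.even_or_odd' j with ⟨M, rfl | rfl⟩
  · obtain ⟨d, hd⟩ : ∃ d, 2 * N + 1 - l = 2 * M + 1 + d :=
      ⟨2 * N + 1 - l - (2 * M + 1), by omega⟩
    rw [hd]
    exact powDvd_tail_term hp4 (q := l - (N + 1)) hr (by omega) hn (by omega)
  · rw [watson_odd_mul_eq_zero (by omega), mul_zero]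
    exact powDvd_zero

end

theorem mainTheorem5 (p r : ℕ) (hp : p.Prime) (hp4 : p % 4 = 3) (hr : 1 ≤ r) :
    RatModEq (p ^ (2 * r + 2))
        (∑ k ∈ Finset.range ((p ^ (2 * r) - 1) / 2 + 1),
          risingFactorial (1 / 2) k ^ 3 / (k.factorial : ℚ) ^ 3)
        ((p : ℚ) ^ (2 * r) * (risingFactorial (3 / 4) ((p ^ (2 * r) - 1) / 2) /
          risingFactorial (5 / 4) ((p ^ (2 * r) - 1) / 2))) ∧
      RatModEq (p ^ (2 * r + 2))
        (∑ k ∈ Finset.range (p ^ (2 * r)),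
          risingFactorial (1 / 2) k ^ 3 / (k.factorial : ℚ) ^ 3)
        ((p : ℚ) ^ (2 * r) * (risingFactorial (3 / 4) ((p ^ (2 * r) - 1) / 2) /
          risingFactorial (5 / 4) ((p ^ (2 * r) - 1) / 2))) := by
  have : Fact p.Prime := ⟨hp⟩
  obtain ⟨M, hM⟩ : ∃ M, p ^ (2 * r) = 4 * M + 1 := by
    have h := one_mod_four_pow_even hp4 r
    exact ⟨p ^ (2 * r) / 4, by omega⟩
  have hN : (p ^ (2 * r) - 1) / 2 = 2 * M := by omega
  have hterm : ∀ k : ℕ, risingFactorial (1 / 2) k ^ 3 / (k.factorial : ℚ) ^ 3 =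
      halfRatio k ^ 3 := fun k => by
    rw [← div_pow, risingFactorial_half_div_factorial]
  simp_rw [hN, hterm]
  have h1 := powDvd_target_sub (p := p) hp4 hM
  refine ⟨h1.ratModEq, PowDvd.ratModEq ?_⟩
  have h2 := powDvd_tail (p := p) (N := 2 * M) hp4 hr (by omega)
  have h3 : p ^ (2 * r) = 2 * (2 * M) + 1 := by omega
  rw [h3, ← Finset.sum_range_add_sum_Ico _ (show 2 * M + 1 ≤ 2 * (2 * M) + 1 by omega),
    add_sub_right_comm]
  exact h1.add h2
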